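/- **Conventions.** Let a group $H$ act on a set $Y$. The (restricted permutational) wreath product is $G\wr H = G^{(Y)}\rtimes H$, where $G^{(Y)}$ is the group of finitely supported maps $Y\to G$ and $H$ permutes the coordinates. The case $Y=H$, with $H$ acting on itself by multiplication, is the regular wreath product. For a surjective homomorphism $\pi$ from the free group on a finite set $S$ onto $G$, the alphabet $\Sigma=S\cup S^{-1}\cup\{1\}$ (with $1$ a padding letter) is called a standard generating set of $G$. Words over $\Sigma$ are evaluated in $G$ through $\pi$. The inverse of a word is $(a_1\cdots a_n)^{-1}=a_n^{-1}\cdots a_1^{-1}$, and the commutator of words is $[u,w]=u^{-1}w^{-1}uw$. A finitely generated group $G$ is *uniformly strongly efficiently non-solvable (uniformly SENS)* if for every finite standard generating set $\Sigma$ there are a constant $\mu\in\mathbb N$ and words $g_{d,v}\in\Sigma^*$ for $d\in\mathbb N$ and $v\in\{0,1\}^{\le d}$ such that 1. $|g_{d,v}|=2^{\mu d}$ for all $d$ and all $v\in\{0,1\}^d$; 2. $g_{d,v}=[g_{d,v0},g_{d,v1}]$ (as words) for all $d$ and all $v\in\{0,1\}^{<d}$; 3. $g_{d,\varepsilon}\ne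 1$ in $G$ for all $d$; 4. given $v\in\{0,1\}^d$, a number $i$ encoded in binary with $\mu d$ bits, and $a\in\Sigma$, a deterministic (multi-tape, random access) Turing machine can decide in linear time whether the $i$-th letter of $g_{d,v}$ is $a$. **Theorem.** Let $G$ be a finitely generated group and let $H$ be a group acting non-trivially on a set $Y$ (for instance, any non-trivial group $H$ acting on $Y=H$ by multiplication). If $G\wr H=G^{(Y)}\rtimes H$ embeds into $G$, then $G$ is uniformly SENS. -/

import Mathlib

/-! ### Restricted permutational wreath products -/

/-- The restricted direct product `G^(Y)`: finitely supported maps `Y → G`, with pointwise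
multiplication. -/
def restrictedPower (G Y : Type*) [Group G] : Subgroup (Y → G) where
  carrier := {f | (Function.mulSupport f).Finite}
  one_mem' := by simp
  mul_mem' {f g} hf hg := by
    have hf' : (Function.mulSupport f).Finite := hf
    have hg' : (Function.mulSupport g).Finite := hg
    exact (hf'.union hg').subset (Function.mulSupport_mul f g)
  inv_mem' {f} hf := by
    have hf' : (Function.mulSupport f).Finite := hf
    show (Function.mulSupport f⁻¹).Finite
    rwa [Function.mulSupport_inv]

theorem restrictedPower_smul_mem {G H Y : Type*} [Group G] [Group H] [MulAction H Y]
    (h : H) {f : Y → G} (hf : f ∈ restrictedPower G Y) :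
    (fun y => f (h⁻¹ • y)) ∈ restrictedPower G Y := by
  have hf' : (Function.mulSupport f).Finite := hf
  exact hf'.preimage (f := fun y : Y => h⁻¹ • y) (MulAction.injective h⁻¹).injOn

/-- The action of `H` on `G^(Y)` by `(h · f) y = f (h⁻¹ • y)`. (A right action `y ↦ y ^ h` is the
left action `h • y = y ^ h⁻¹`, so that this is `(h · f) y = f (y ^ h)`.) -/
def wreathAction (G H Y : Type*) [Group G] [Group H] [MulAction H Y] :
    H →* MulAut (restrictedPower G Y) where
  toFun h :=
    { toFun := fun f => ⟨fun y => f.1 (h⁻¹ • y), restrictedPower_smul_mem h f.2⟩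
      invFun := fun f => ⟨fun y => f.1 (h • y), by
        simpa using restrictedPower_smul_mem h⁻¹ f.2⟩
      left_inv := fun f => by ext y; simp
      right_inv := fun f => by ext y; simp
      map_mul' := fun f g => rfl }
  map_one' := by ext f y; simp
  map_mul' h k := by ext f y; simp [mul_smul]

/-- The restricted (permutational) wreath product `G ≀ H = G^(Y) ⋊ H` of `G` with a group `H`
acting on `Y`. For `Y = H` with `H` acting by multiplication it is the regular wreath product. -/
abbrev WreathProduct (G H Y : Type*) [Group G] [Group H] [MulAction H Y] : Type _ :=
  restrictedPower G Y ⋊[wreathAction G H Y] H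

/-! ### Deterministic random access Turing machines and linear time -/

/-- The number with binary notation `l`, most significant bit first. -/
def binaryValue (l : List Bool) : ℕ :=
  l.foldl (fun n b => 2 * n + b.toNat) 0

/-- A two-way infinite tape: the cell under the head, and the cells to the left and to the right of
it, nearest first. All cells beyond the two lists are blank. -/
structure MachineTape (A : Type*) where
  left : List A
  head : A
  right : List A

namespace MachineTape

variable {A : Type*}

/-- The tape with `l` written on it and the head on the first letter of `l`. -/
def ofList (blank : A) (l : List A) : MachineTape A :=
  ⟨[], l.headD blank, l.tail⟩

/-- Overwrite the cell under the head. -/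
def write (a : A) (T : MachineTape A) : MachineTape A :=
  ⟨T.left, a, T.right⟩

/-- Move the head by one cell (`none`: the head stays). -/
def move (blank : A) : Option Turing.Dir → MachineTape A → MachineTape A
  | none, T => T
  | some Turing.Dir.left, T => ⟨T.left.tail, T.left.headD blank, T.head :: T.right⟩
  | some Turing.Dir.right, T => ⟨T.head :: T.left, T.right.headD blank, T.right.tail⟩

/-- The word written on the tape, from left to right. -/
def contents (T : MachineTape A) : List A :=
  T.left.reverse ++ T.head :: T.right

end MachineTape

/-- What a machine with `k` work tapes does in one step: the new state, the move on the (read-only)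
input tape, the letter to write and the move on each work tape, and the letter to write and the move
on the index tape. -/
structure MachineAction (Q A : Type) (k : ℕ) where
  state : Q
  inputMove : Option Turing.Dir
  work : Fin k → A × Option Turing.Dir
  index : Option Bool × Option Turing.Dir

/-- A deterministic Turing machine with random access and with input alphabet `Γ`: a finite control,
a read-only input tape, `k` work tapes, and an additional index tape over `0`, `1`, blank.
The transition depends on the state, on an input letter (`none` for a blank), and on the letters
under the heads of the work tapes and the index tape. The input letter is the one under the input
head, except in a query state, where it is the letter at the position that is written on the index
tape. The machine halts where no transition is given. -/
structure RandomAccessTM (Γ : Type*) where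
  Q : Type
  [finiteQ : Finite Q]
  A : Type
  [finiteA : Finite A]
  blank : A
  k : ℕ
  start : Q
  accepting : Set Q
  query : Set Q
  trans : Q → Option Γ → (Fin k → A) → Option Bool → Option (MachineAction Q A k)

namespace RandomAccessTM

variable {Γ : Type*} (M : RandomAccessTM Γ)

/-- The configurations of `M` on a fixed input. -/
structure Cfg where
  state : M.Q
  input : MachineTape (Option Γ)
  work : Fin M.k → MachineTape M.A
  index : MachineTape (Option Bool)

/-- The initial configuration on input `w`. -/
def init (w : List Γ) : M.Cfg where
  state := M.start
  input := MachineTape.ofList none (w.map some)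
  work := fun _ => MachineTape.ofList M.blank []
  index := MachineTape.ofList none []

open Classical in
/-- The input letter that the next transition from `c` depends on. Positions are counted from `0`,
and there is a blank at a position outside of the input. -/
noncomputable def inputLetter (w : List Γ) (c : M.Cfg) : Option Γ :=
  if c.state ∈ M.query then w[binaryValue (c.index.contents.filterMap id)]? else c.input.head

/-- The transition that applies in the configuration `c`, if any. -/
noncomputable def action (w : List Γ) (c : M.Cfg) : Option (MachineAction M.Q M.A M.k) :=
  M.trans c.state (M.inputLetter w c) (fun j => (c.work j).head) c.index.head

/-- Perform an action. -/
def perform (a : MachineAction M.Q M.A M.k) (c : M.Cfg) : M.Cfg where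
  state := a.state
  input := c.input.move none a.inputMove
  work := fun j => ((c.work j).write (a.work j).1).move M.blank (a.work j).2
  index := (c.index.write a.index.1).move none a.index.2

/-- One step on input `w`; `none` if `c` is a halting configuration. -/
noncomputable def step (w : List Γ) (c : M.Cfg) : Option M.Cfg :=
  (M.action w c).map fun a => M.perform a c

/-- After exactly `t` steps on input `w`, the machine halts in the configuration `c`. -/
def HaltsAt (w : List Γ) (t : ℕ) (c : M.Cfg) : Prop :=
  (fun o : Option M.Cfg => o.bind (M.step w))^[t] (some (M.init w)) = some c ∧ M.step w c = none

end RandomAccessTM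

/-- The class of languages (over a finite alphabet) that are decided in linear time by a
deterministic Turing machine with random access. -/
def DLINTIME {Γ : Type*} [Finite Γ] (L : Language Γ) : Prop :=
  ∃ (M : RandomAccessTM Γ) (C : ℕ), ∀ w : List Γ, ∃ (t : ℕ) (c : M.Cfg),
    t ≤ C * (w.length + 1) ∧ M.HaltsAt w t c ∧ (c.state ∈ M.accepting ↔ w ∈ L)

/-! ### Words over standard generating sets -/

/-- The standard alphabet `Σ = S ∪ S⁻¹ ∪ {1}`: `none` is the letter `1`, `some (s, true)` is `s`
and `some (s, false)` is `s⁻¹`. -/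
abbrev StdLetter (S : Type*) : Type _ := Option (S × Bool)

/-- The involution on `Σ`. -/
def StdLetter.inv {S : Type*} : StdLetter S → StdLetter S
  | none => none
  | some (s, b) => some (s, !b)

/-- The formal inverse of a word. -/
def wordInv {S : Type*} (w : List (StdLetter S)) : List (StdLetter S) :=
  (w.map StdLetter.inv).reverse

/-- The commutator `[u, w] = u⁻¹ w⁻¹ u w` of words. -/
def wordCommutator {S : Type*} (u w : List (StdLetter S)) : List (StdLetter S) :=
  wordInv u ++ wordInv w ++ u ++ w

/-- The value in `G` of a letter. -/
def letterValue {S G : Type*} [Group G] (π : FreeGroup S →* G) : StdLetter S → G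
  | none => 1
  | some (s, true) => π (FreeGroup.of s)
  | some (s, false) => (π (FreeGroup.of s))⁻¹

/-- The value in `G` of a word. -/
def wordValue {S G : Type*} [Group G] (π : FreeGroup S →* G) (w : List (StdLetter S)) : G :=
  (w.map (letterValue π)).prod

/-! ### Uniformly strongly efficiently non-solvable groups -/

/-- The input alphabet `{0, 1} ∪ Σ ∪ {#}` (`none` is the separator `#`). -/
abbrev QueryLetter (S : Type*) : Type _ := Option (Bool ⊕ StdLetter S)

/-- The triple `(v, i, a)` as an input word `v # i # a`. -/
def encodeQuery {S : Type*} (v i : List Bool) (a : StdLetter S) : List (QueryLetter S) :=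
  v.map (fun b => some (Sum.inl b)) ++ none :: i.map (fun b => some (Sum.inl b)) ++
    [none, some (Sum.inr a)]

/-- The set of the triples `(v, i, a)` such that, with `d = |v|`, the number `i` is given in binary
with `μ d` bits and the `i`-th letter (counted from `0`) of `g d v` is `a`. -/
def letterLanguage {S : Type*} (μ : ℕ) (g : ℕ → List Bool → List (StdLetter S)) :
    Language (QueryLetter S) :=
  {w | ∃ (v i : List Bool) (a : StdLetter S), w = encodeQuery v i a ∧
    i.length = μ * v.length ∧ (g v.length v)[binaryValue i]? = some a}

/-- `G` is uniformly SENS with respect to the standard generating set given by `π`. Only the words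
`g d v` with `|v| ≤ d` matter. -/
def UniformlySENSFor {S G : Type*} [Finite S] [Group G] (π : FreeGroup S →* G) : Prop :=
  ∃ (μ : ℕ) (g : ℕ → List Bool → List (StdLetter S)),
    (∀ (d : ℕ) (v : List Bool), v.length = d → (g d v).length = 2 ^ (μ * d)) ∧
    (∀ (d : ℕ) (v : List Bool), v.length < d →
      g d v = wordCommutator (g d (v ++ [false])) (g d (v ++ [true]))) ∧
    (∀ d : ℕ, wordValue π (g d []) ≠ 1) ∧
    DLINTIME (letterLanguage μ g)

/-- `G` is finitely generated, and uniformly SENS with respect to each of its finite standard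
generating sets. -/
def UniformlySENS (G : Type*) [Group G] : Prop :=
  Group.FG G ∧ ∀ (S : Type) [Finite S] (π : FreeGroup S →* G), Function.Surjective π →
    UniformlySENSFor π

/-! ### Nested commutators -/

/-! Choose `h` and `y` with `h • y ≠ y`. Let t be the image of `h` under `ι`, and let φ : G → G be
`ι` composed with the inclusion of the coordinate `y`. Then [φ(x), t] is the image of a map in G^(Y)
whose value at h⁻¹y is x, so x can be recovered from it.

Label the binary tree by F(ε) = a letter of nontrivial value, F(v0) = φ(F(v)), F(v1) = t. The lowest
layer of commutators then lies in the image of G^(Y). As `ι` is injective, projecting to the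
coordinate h⁻¹y turns the nested commutator of height n + 1 into that of height n, so none of them
is trivial (`nestedCommutator_ne_one`).

On words, φ is a substitution replacing every letter by a padded word of length 2^μ. A word for t of
the length required at v1 is obtained from the word at v by carrying one marked position: the marked
letter becomes a word for t, and all others become padding. Hence each letter of a leaf word is the
output of a finite automaton reading v together with the position, μ bits of the position per bit of
v (`getElem?_leafWord`), and a machine simulates this automaton in linear time
(`dlintime_letterLanguage`). -/

/-- The value at the node `v` of the binary tree of commutators `[x, y] = x⁻¹ y⁻¹ x y` of height `n`
below `v` whose leaves are given by `f`. -/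
def nestedCommutator {G : Type*} [Group G] : ℕ → (List Bool → G) → List Bool → G
  | 0, f, v => f v
  | n + 1, f, v =>
    (nestedCommutator n f (v ++ [false]))⁻¹ * (nestedCommutator n f (v ++ [true]))⁻¹ *
      nestedCommutator n f (v ++ [false]) * nestedCommutator n f (v ++ [true])

/-- The definition peels off the commutator at the root; the induction on the height has to remove
the lowest layer instead. -/
theorem nestedCommutator_succ_leaves {G : Type*} [Group G] (n : ℕ) (f : List Bool → G)
    (v : List Bool) :
    nestedCommutator (n + 1) f v = nestedCommutator n
      (fun u => (f (u ++ [false]))⁻¹ * (f (u ++ [true]))⁻¹ * f (u ++ [false]) * f (u ++ [true]))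
      v := by
  induction n generalizing v with
  | zero => rfl
  | succ n ih => rw [nestedCommutator, ih, ih]; rfl

theorem map_nestedCommutator {G K : Type*} [Group G] [Group K] (φ : G →* K) (n : ℕ)
    (f : List Bool → G) (v : List Bool) :
    φ (nestedCommutator n f v) = nestedCommutator n (fun u => φ (f u)) v := by
  induction n generalizing v with
  | zero => rfl
  | succ n ih => simp only [nestedCommutator, map_mul, map_inv, ih]

/-! ### Coordinates of wreath products -/

open Classical in
/-- The embedding of `G` into `G^(Y)` at the coordinate `y`. -/
noncomputable def coordinateHom (G : Type*) {Y : Type*} [Group G] (y : Y) :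
    G →* restrictedPower G Y where
  toFun x := ⟨Pi.mulSingle y x, (Set.finite_singleton y).subset Pi.mulSupport_mulSingle_subset⟩
  map_one' := by ext; simp
  map_mul' a b := by ext z; simp [Pi.mulSingle_mul]

/-- The projection of `G^(Y)` to the coordinate `z`. -/
def coordinateProj (G : Type*) {Y : Type*} [Group G] (z : Y) : restrictedPower G Y →* G where
  toFun f := f.1 z
  map_one' := rfl
  map_mul' _ _ := rfl

section

variable {G H Y : Type*} [Group G] [Group H] [MulAction H Y]

/-- Conjugation by h preserves the base group and acts on it through `wreathAction`, so the
commutator falls back into G^(Y). -/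
theorem inl_mul_inr_commutator (f : restrictedPower G Y) (h : H) :
    (SemidirectProduct.inl f : WreathProduct G H Y)⁻¹ * (SemidirectProduct.inr h)⁻¹ *
      SemidirectProduct.inl f * SemidirectProduct.inr h =
    SemidirectProduct.inl (f⁻¹ * wreathAction G H Y h⁻¹ f) := by
  rw [map_mul, SemidirectProduct.inl_aut]
  simp [mul_assoc]

/-- The translate by h⁻¹ takes at z the value of the original map at h • z, so it contributes x at
h⁻¹y; the inverted factor is trivial there because h⁻¹y ≠ y. -/
theorem coordinateProj_commutator (y : Y) (h : H) (hy : h • y ≠ y) (x : G) :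
    coordinateProj G (h⁻¹ • y)
      ((coordinateHom G y x)⁻¹ * wreathAction G H Y h⁻¹ (coordinateHom G y x)) = x := by
  have hne : h⁻¹ • y ≠ y := fun e => hy (by nth_rw 1 [← e]; simp)
  simp only [coordinateProj, coordinateHom, wreathAction]
  simp
  exact @Function.update_of_ne _ _ (_) _ _ hne _ _

/-- If the leaves `F n` are built from `F 0` by embedding `F n v` at a coordinate as the left child
of `v` and taking a fixed group element moving this coordinate as right child, then the nested
commutators are nontrivial. -/
theorem nestedCommutator_ne_one (ι : WreathProduct G H Y →* G) (hι : Function.Injective ι)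
    (y : Y) (h : H) (hy : h • y ≠ y) (F : List Bool → G) (h0 : F [] ≠ 1)
    (hfalse : ∀ v, F (v ++ [false]) = ι (SemidirectProduct.inl (coordinateHom G y (F v))))
    (htrue : ∀ v, F (v ++ [true]) = ι (SemidirectProduct.inr h)) (n : ℕ) :
    nestedCommutator n F [] ≠ 1 := by
  induction n with
  | zero => exact h0
  | succ n ih =>
    intro e
    rw [nestedCommutator_succ_leaves] at e
    simp only [hfalse, htrue, ← map_inv ι, ← map_mul ι, inl_mul_inr_commutator] at e
    -- Both homomorphisms move out of the tree, and their injectivity leaves an equation in G^(Y).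
    rw [← map_nestedCommutator ι n, ← map_nestedCommutator SemidirectProduct.inl n,
      map_eq_one_iff _ hι, map_eq_one_iff _ SemidirectProduct.inl_injective] at e
    have e' := congrArg (coordinateProj G (h⁻¹ • y)) e
    rw [map_nestedCommutator, map_one] at e'
    simp only [coordinateProj_commutator y h hy] at e'
    exact ih e'

end

/-! ### Words -/

section

variable {S G : Type*} [Group G] (π : FreeGroup S →* G)

theorem wordValue_append (u w : List (StdLetter S)) :
    wordValue π (u ++ w) = wordValue π u * wordValue π w := by
  simp [wordValue]

theorem letterValue_inv (a : StdLetter S) : letterValue π a.inv = (letterValue π a)⁻¹ := by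
  rcases a with _ | ⟨s, _ | _⟩ <;> simp [StdLetter.inv, letterValue]

theorem wordValue_wordInv (w : List (StdLetter S)) :
    wordValue π (wordInv w) = (wordValue π w)⁻¹ := by
  induction w with
  | nil => simp [wordInv, wordValue]
  | cons a w ih =>
    have : wordInv (a :: w) = wordInv w ++ [a.inv] := by simp [wordInv]
    rw [this, wordValue_append, ih]
    simp [wordValue, letterValue_inv]

theorem wordValue_replicate_none (n : ℕ) :
    wordValue π (List.replicate n none) = 1 := by
  simp [wordValue, letterValue]

theorem exists_wordValue_eq (hπ : Function.Surjective π) (x : G) : ∃ w, wordValue π w = x := by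
  obtain ⟨y, rfl⟩ := hπ x
  induction y using FreeGroup.induction_on with
  | C1 => exact ⟨[], by simp [wordValue]⟩
  | of s => exact ⟨[some (s, true)], by simp [wordValue, letterValue]⟩
  | inv_of s _ => exact ⟨[some (s, false)], by simp [wordValue, letterValue]⟩
  | mul a b ha hb =>
    obtain ⟨u, hu⟩ := ha
    obtain ⟨w, hw⟩ := hb
    exact ⟨u ++ w, by rw [wordValue_append, hu, hw, map_mul]⟩

/-- Padding with the letter 1 brings finitely many words to any common length that is large enough,
in particular to a power of 2. -/
theorem exists_length_forall_wordValue_eq (hπ : Function.Surjective π) {I : Type*} [Finite I]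
    (x : I → G) :
    ∃ n : ℕ, ∀ m ≥ n, ∃ w : I → List (StdLetter S),
      ∀ i, (w i).length = m ∧ wordValue π (w i) = x i := by
  choose w hw using exists_wordValue_eq π hπ
  obtain ⟨n, hn⟩ := (Set.finite_range fun i => (w (x i)).length).bddAbove
  refine ⟨n, fun m hm => ⟨fun i => w (x i) ++ List.replicate (m - (w (x i)).length) none,
    fun i => ⟨?_, ?_⟩⟩⟩
  · have := hn ⟨i, rfl⟩
    simp only [List.length_append, List.length_replicate]
    simp only at this
    omega
  · rw [wordValue_append, hw, wordValue_replicate_none, mul_one]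

theorem exists_letterValue_ne_one (hπ : Function.Surjective π) [Nontrivial G] :
    ∃ a : StdLetter S, letterValue π a ≠ 1 := by
  by_contra! hc
  obtain ⟨x, hx⟩ := exists_ne (1 : G)
  obtain ⟨w, rfl⟩ := exists_wordValue_eq π hπ x
  exact hx (List.prod_eq_one (by simpa using fun a _ => hc a))

end

/-- The words at the nodes of a tree of commutators of height `n` below the node, with leaves `f`. -/
def nestedWordCommutator {S : Type*} :
    ℕ → (List Bool → List (StdLetter S)) → List Bool → List (StdLetter S)
  | 0, f, v => f v
  | n + 1, f, v =>
    wordCommutator (nestedWordCommutator n f (v ++ [false])) (nestedWordCommutator n f (v ++ [true]))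

theorem wordValue_nestedWordCommutator {S G : Type*} [Group G] (π : FreeGroup S →* G) (n : ℕ)
    (f : List Bool → List (StdLetter S)) (v : List Bool) :
    wordValue π (nestedWordCommutator n f v) =
      nestedCommutator n (fun u => wordValue π (f u)) v := by
  induction n generalizing v with
  | zero => rfl
  | succ n ih =>
    simp only [nestedWordCommutator, nestedCommutator, wordCommutator, wordValue_append,
      wordValue_wordInv, ih]

/-! ### Leaf words -/

section

variable {S : Type*}

/-- The letter at position `r` of the block that replaces the letter `p.1`, and the mark of this
position. Blocks for `false` are given by the substitution `σ`; blocks for `true` are `τ` at the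
marked letter and trivial elsewhere. The mark stays at the first position. -/
def blockLetter (σ : StdLetter S → List (StdLetter S)) (τ : List (StdLetter S))
    (p : StdLetter S × Bool) (b : Bool) (r : ℕ) : StdLetter S × Bool :=
  (((if b then (if p.2 then τ else []) else σ p.1)[r]?).getD none, p.2 && r == 0)

/-- The list of all letters that replace `w` under `step · b`. -/
def expand {X : Type*} (m : ℕ) (step : X → Bool → ℕ → X) (w : List X) (b : Bool) : List X :=
  w.flatMap fun p => (List.range m).map (step p b)

theorem length_expand {X : Type*} (m : ℕ) (step : X → Bool → ℕ → X) (w : List X) (b : Bool) :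
    (expand m step w b).length = w.length * m := by
  simp [expand, List.length_flatMap]

theorem getElem?_expand {X : Type*} (m : ℕ) (step : X → Bool → ℕ → X) (w : List X) (b : Bool)
    (q r : ℕ) (hr : r < m) :
    (expand m step w b)[q * m + r]? = (w[q]?).map fun p => step p b r := by
  induction w generalizing q with
  | nil => simp [expand]
  | cons p w ih =>
    have e : expand m step (p :: w) b = (List.range m).map (step p b) ++ expand m step w b := by
      simp [expand]
    rw [e]
    cases q with
    | zero => simp [List.getElem?_append_left, hr]
    | succ q =>
      rw [List.getElem?_append_right (by simp; nlinarith)]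
      have : (q + 1) * m + r - ((List.range m).map (step p b)).length = q * m + r := by
        simp only [List.length_map, List.length_range, add_mul, one_mul]
        omega
      rw [this, ih]
      simp

theorem binaryValue_append (a b : List Bool) :
    binaryValue (a ++ b) = binaryValue a * 2 ^ b.length + binaryValue b := by
  induction b using List.reverseRecOn with
  | nil => simp [binaryValue]
  | append_singleton b c ih =>
    have h : ∀ l : List Bool, binaryValue (l ++ [c]) = 2 * binaryValue l + c.toNat := fun l => by
      simp [binaryValue]
    rw [← List.append_assoc, h, h, ih, List.length_append, List.length_singleton]
    ring

theorem binaryValue_lt (l : List Bool) : binaryValue l < 2 ^ l.length := by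
  induction l using List.reverseRecOn with
  | nil => simp [binaryValue]
  | append_singleton b c ih =>
    have h : binaryValue (b ++ [c]) = 2 * binaryValue b + c.toNat := by simp [binaryValue]
    have := c.toNat_lt
    rw [h, List.length_append, List.length_singleton, pow_succ]
    omega

/-- Read `v` and `i` simultaneously, with `μ` bits of `i` for each bit of `v`. -/
def runBlocks {X : Type*} (μ : ℕ) (step : X → Bool → ℕ → X) : X → List Bool → List Bool → X
  | x, [], _ => x
  | x, b :: v, i => runBlocks μ step (step x b (binaryValue (i.take μ))) v (i.drop μ)

/-- The first bit of v expands the starting word, and the leading μ bits of i give the place inside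
the new block. Hence the induction must let the starting word and the position q in it vary. -/
theorem getElem?_foldl_expand {X : Type*} (μ : ℕ) (step : X → Bool → ℕ → X) (v : List Bool)
    (w : List X) (i : List Bool) (hi : i.length = μ * v.length) (q : ℕ) :
    (v.foldl (expand (2 ^ μ) step) w)[q * 2 ^ (μ * v.length) + binaryValue i]? =
      (w[q]?).map fun p => runBlocks μ step p v i := by
  induction v generalizing w i q with
  | nil =>
    obtain rfl : i = [] := by simpa using hi
    simp [runBlocks, binaryValue]
  | cons b v ih =>
    have hl : (i.take μ).length = μ := by
      rw [List.length_take, hi, List.length_cons]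
      exact min_eq_left (Nat.le_mul_of_pos_right _ (by simp))
    have hd : (i.drop μ).length = μ * v.length := by
      rw [List.length_drop, hi, List.length_cons, mul_add, mul_one, Nat.add_sub_cancel]
    have hlt := binaryValue_lt (i.take μ)
    rw [hl] at hlt
    have hq : q * 2 ^ (μ * (b :: v).length) + binaryValue i =
        (q * 2 ^ μ + binaryValue (i.take μ)) * 2 ^ (μ * v.length) + binaryValue (i.drop μ) := by
      conv_lhs => rw [← List.take_append_drop μ i, binaryValue_append, hd, List.length_cons]
      ring
    rw [hq, List.foldl_cons, ih _ _ hd, getElem?_expand _ _ _ _ _ _ hlt, Option.map_map]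
    rfl

/-- The marked word at the leaf `v`. -/
def leafWord (μ : ℕ) (step : StdLetter S × Bool → Bool → ℕ → StdLetter S × Bool) (a : StdLetter S)
    (v : List Bool) : List (StdLetter S × Bool) :=
  v.foldl (expand (2 ^ μ) step) [(a, true)]

theorem length_leafWord (μ : ℕ) (step : StdLetter S × Bool → Bool → ℕ → StdLetter S × Bool)
    (a : StdLetter S) (v : List Bool) :
    (leafWord μ step a v).length = 2 ^ (μ * v.length) := by
  induction v using List.reverseRecOn with
  | nil => simp [leafWord]
  | append_singleton v b ih =>
    unfold leafWord at ih ⊢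
    rw [List.foldl_append, List.foldl_cons, List.foldl_nil, length_expand, ih]
    simp [mul_add, pow_add]

theorem getElem?_leafWord (μ : ℕ) (step : StdLetter S × Bool → Bool → ℕ → StdLetter S × Bool)
    (a : StdLetter S) (v i : List Bool) (hi : i.length = μ * v.length) :
    (leafWord μ step a v)[binaryValue i]? = some (runBlocks μ step (a, true) v i) := by
  have := getElem?_foldl_expand μ step v [(a, true)] i hi 0
  simpa [leafWord] using this

variable {G : Type*} [Group G] (π : FreeGroup S →* G)
  (σ : StdLetter S → List (StdLetter S)) (τ : List (StdLetter S))

theorem map_range_getD (m : ℕ) (w : List (StdLetter S)) (hw : w.length = m) :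
    (List.range m).map (fun r => (w[r]?).getD none) = w := by
  apply List.ext_getElem
  · simp [hw]
  · intro n h1 h2
    simp [h2]

theorem wordValue_block_false {m : ℕ} (hσ : ∀ a, (σ a).length = m) (p : StdLetter S × Bool) :
    wordValue π (((List.range m).map (blockLetter σ τ p false)).map Prod.fst) =
      wordValue π (σ p.1) := by
  rw [List.map_map]
  exact congrArg (wordValue π) (map_range_getD m _ (hσ p.1))

theorem wordValue_block_true {m : ℕ} (hτ : τ.length = m) (p : StdLetter S × Bool) :
    wordValue π (((List.range m).map (blockLetter σ τ p true)).map Prod.fst) =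
      if p.2 then wordValue π τ else 1 := by
  rw [List.map_map]
  split_ifs with h
  · refine congrArg (wordValue π) (Eq.trans ?_ (map_range_getD m _ hτ))
    exact List.map_congr_left fun r _ => by simp [blockLetter, h]
  · have : (List.range m).map (Prod.fst ∘ blockLetter σ τ p true) = List.replicate m none := by
      rw [List.eq_replicate_iff]
      simp [blockLetter, h]
    rw [this, wordValue_replicate_none]

theorem wordValue_expand_false {m : ℕ} (φ : G →* G) (hσ : ∀ a, (σ a).length = m)
    (hφ : ∀ a, wordValue π (σ a) = φ (letterValue π a)) (w : List (StdLetter S × Bool)) :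
    wordValue π ((expand m (blockLetter σ τ) w false).map Prod.fst) =
      φ (wordValue π (w.map Prod.fst)) := by
  induction w with
  | nil => simp [expand, wordValue]
  | cons p w ih =>
    have e : expand m (blockLetter σ τ) (p :: w) false =
        (List.range m).map (blockLetter σ τ p false) ++ expand m (blockLetter σ τ) w false := by
      simp [expand]
    rw [e, List.map_append, wordValue_append, ih, wordValue_block_false π σ τ hσ, hφ, ← map_mul]
    simp [wordValue]

/-- Each marked letter contributes one copy of τ and every other block is padding. Leaf words carry
exactly one mark (`countP_snd_leafWord`), so the exponent will be 1. -/
theorem wordValue_expand_true {m : ℕ} (hτ : τ.length = m) (w : List (StdLetter S × Bool)) :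
    wordValue π ((expand m (blockLetter σ τ) w true).map Prod.fst) =
      wordValue π τ ^ (w.countP Prod.snd) := by
  induction w with
  | nil => simp [expand, wordValue]
  | cons p w ih =>
    have e : expand m (blockLetter σ τ) (p :: w) true =
        (List.range m).map (blockLetter σ τ p true) ++ expand m (blockLetter σ τ) w true := by
      simp [expand]
    rw [e, List.map_append, wordValue_append, ih, wordValue_block_true π σ τ hτ, List.countP_cons]
    split_ifs <;> simp [pow_succ']

/-- The mark of a letter passes to the first position of its block, which exists because m is
positive. -/
theorem countP_snd_expand {m : ℕ} (hm : 0 < m) (w : List (StdLetter S × Bool)) (b : Bool) :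
    (expand m (blockLetter σ τ) w b).countP Prod.snd = w.countP Prod.snd := by
  obtain ⟨n, rfl⟩ : ∃ n, m = n + 1 := ⟨m - 1, by omega⟩
  induction w with
  | nil => simp [expand]
  | cons p w ih =>
    have e : expand (n + 1) (blockLetter σ τ) (p :: w) b =
        (List.range (n + 1)).map (blockLetter σ τ p b) ++
          expand (n + 1) (blockLetter σ τ) w b := by
      simp [expand]
    rw [e, List.countP_append, ih, List.countP_cons, List.range_succ_eq_map, List.map_cons,
      List.countP_cons, add_comm]
    have h0 : ((List.range n).map Nat.succ |>.map (blockLetter σ τ p b)).countP Prod.snd = 0 := by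
      rw [List.countP_eq_zero]
      simp [blockLetter]
    rw [h0]
    simp [blockLetter]

theorem countP_snd_leafWord (μ : ℕ) (a : StdLetter S) (v : List Bool) :
    (leafWord μ (blockLetter σ τ) a v).countP Prod.snd = 1 := by
  induction v using List.reverseRecOn with
  | nil => simp [leafWord]
  | append_singleton v b ih =>
    unfold leafWord at ih ⊢
    rw [List.foldl_append, List.foldl_cons, List.foldl_nil, countP_snd_expand _ _ (by positivity),
      ih]

theorem wordValue_leafWord_false {μ : ℕ} (φ : G →* G) (hσ : ∀ a, (σ a).length = 2 ^ μ)
    (hφ : ∀ a, wordValue π (σ a) = φ (letterValue π a)) (a : StdLetter S) (v : List Bool) :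
    wordValue π ((leafWord μ (blockLetter σ τ) a (v ++ [false])).map Prod.fst) =
      φ (wordValue π ((leafWord μ (blockLetter σ τ) a v).map Prod.fst)) := by
  unfold leafWord
  rw [List.foldl_append, List.foldl_cons, List.foldl_nil, wordValue_expand_false π σ τ φ hσ hφ]

theorem wordValue_leafWord_true {μ : ℕ} (hτ : τ.length = 2 ^ μ) (a : StdLetter S)
    (v : List Bool) :
    wordValue π ((leafWord μ (blockLetter σ τ) a (v ++ [true])).map Prod.fst) =
      wordValue π τ := by
  have h := countP_snd_leafWord σ τ μ a v
  unfold leafWord at h ⊢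
  rw [List.foldl_append, List.foldl_cons, List.foldl_nil, wordValue_expand_true π σ τ hτ, h,
    pow_one]

end

/-! ### A machine that reads two words simultaneously -/

namespace RandomAccessTM

variable {Γ : Type*} (M : RandomAccessTM Γ)

/-- From the configuration `c`, the machine halts after at most `n` steps, and accepts if and only
if `P` holds. -/
def Decides (w : List Γ) (c : M.Cfg) (n : ℕ) (P : Prop) : Prop :=
  ∃ (t : ℕ) (c' : M.Cfg), t ≤ n ∧
    (fun o : Option M.Cfg => o.bind (M.step w))^[t] (some c) = some c' ∧ M.step w c' = none ∧
    (c'.state ∈ M.accepting ↔ P)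

variable {M}

theorem Decides.of_halt {w : List Γ} {c : M.Cfg} {P : Prop} (n : ℕ) (h : M.step w c = none)
    (hP : c.state ∈ M.accepting ↔ P) : M.Decides w c n P :=
  ⟨0, c, Nat.zero_le _, rfl, h, hP⟩

/-- Phases are verified from the last one backwards; the two propositions let the condition on the
remaining input change form with each step. -/
theorem Decides.of_step {w : List Γ} {c c' : M.Cfg} {n m : ℕ} {P Q : Prop}
    (hd : M.Decides w c' n Q) (h : M.step w c = some c') (hm : n + 1 ≤ m) (hPQ : Q ↔ P) :
    M.Decides w c m P := by
  obtain ⟨t, d, ht, hi, hs, ha⟩ := hd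
  refine ⟨t + 1, d, by omega, ?_, hs, ha.trans hPQ⟩
  rw [Function.iterate_succ_apply, Option.bind_some, h, hi]

end RandomAccessTM

theorem DLINTIME_of_decides {Γ : Type*} [Finite Γ] {L : Language Γ} (M : RandomAccessTM Γ) (C : ℕ)
    (h : ∀ w, M.Decides w (M.init w) (C * (w.length + 1)) (w ∈ L)) : DLINTIME L :=
  ⟨M, C, fun w => by
    obtain ⟨t, c, ht, hi, hs, ha⟩ := h w
    exact ⟨t, c, ht, ⟨hi, hs⟩, ha⟩⟩

/-- The states of the machine: copying `v` to the work tape, going back to the beginning of `v`,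
reading `v` and `i` (with the current value and the pending bits of `i`), comparing the letter,
checking the end of the input, and accepting. -/
inductive ReaderState (X : Type) (μ : ℕ) : Type
  | copy
  | rewind
  | scan (x : X) (l : {l : List Bool // l.length ≤ μ})
  | letter (x : X)
  | atEnd
  | accept

instance {X : Type} {μ : ℕ} [Finite X] : Finite (ReaderState X μ) := by
  have : Finite {l : List Bool // l.length ≤ μ} := List.finite_length_le Bool μ
  let f : (X × {l : List Bool // l.length ≤ μ}) ⊕ X ⊕ Fin 4 → ReaderState X μ
    | .inl (x, l) => .scan x l
    | .inr (.inl x) => .letter x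
    | .inr (.inr 0) => .copy
    | .inr (.inr 1) => .rewind
    | .inr (.inr 2) => .atEnd
    | .inr (.inr 3) => .accept
  refine Finite.of_surjective f ?_
  rintro (_ | _ | ⟨x, l⟩ | x | _ | _)
  · exact ⟨.inr (.inr 0), rfl⟩
  · exact ⟨.inr (.inr 1), rfl⟩
  · exact ⟨.inl (x, l), rfl⟩
  · exact ⟨.inr (.inl x), rfl⟩
  · exact ⟨.inr (.inr 2), rfl⟩
  · exact ⟨.inr (.inr 3), rfl⟩

section

variable {S X : Type} (μ : ℕ) (step : X → Bool → ℕ → X) (out : X → StdLetter S) (x₀ : X)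

/-- An action that leaves the index tape blank. -/
def readerAction (q : ReaderState X μ) (i : Option Turing.Dir) (a : Option Bool)
    (d : Option Turing.Dir) : MachineAction (ReaderState X μ) (Option Bool) 1 :=
  ⟨q, i, fun _ => (a, d), (none, none)⟩

open Classical in
/-- The transitions of the machine. -/
noncomputable def readerTrans (q : ReaderState X μ) (c : Option (QueryLetter S)) (a : Option Bool) :
    Option (MachineAction (ReaderState X μ) (Option Bool) 1) :=
  match q, c, a with
  | .copy, some (some (.inl b)), _ =>
    some (readerAction μ .copy (some .right) (some b) (some .right))
  | .copy, some none, _ => some (readerAction μ .rewind (some .right) none (some .left))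
  | .rewind, _, some b => some (readerAction μ .rewind none (some b) (some .left))
  | .rewind, _, none => some (readerAction μ (.scan x₀ ⟨[], by simp⟩) none none (some .right))
  | .scan x l, some (some (.inl c)), some b =>
    -- The work head, which reads v, advances only when the μ-th pending bit completes a block.
    if h : l.1.length + 1 < μ then
      some (readerAction μ (.scan x ⟨l.1 ++ [c], by simpa using h.le⟩) (some .right) (some b) none)
    else
      some (readerAction μ (.scan (step x b (binaryValue (l.1 ++ [c]))) ⟨[], by simp⟩)
        (some .right) (some b) (some .right))
  | .scan x l, some none, none =>
    -- Being at the end of v with no pending bits means that i had exactly μ|v| bits.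
    if l.1 = [] then some (readerAction μ (.letter x) (some .right) none none) else none
  | .letter x, some (some (.inr a)), _ =>
    if a = out x then some (readerAction μ .atEnd (some .right) none none) else none
  | .atEnd, none, _ => some (readerAction μ .accept none none none)
  | _, _, _ => none

/-- The machine that, on input `v # i # a`, reads `v` and `i` simultaneously, and compares the
resulting letter with `a`. -/
noncomputable def readerTM [Finite X] : RandomAccessTM (QueryLetter S) where
  Q := ReaderState X μ
  A := Option Bool
  blank := none
  k := 1
  start := .copy
  accepting := {.accept}
  -- Sequential reading suffices once v is copied to the work tape, so random access is never used.
  query := ∅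
  trans q c a _ := readerTrans μ step out x₀ q c (a 0)

/-- The configuration in state `q` with remaining input `u`, and with `wl`, `wr` on the work tape to
the left of the head and from the head onwards. -/
def readerCfg [Finite X] (q : ReaderState X μ) (il : List (Option (QueryLetter S)))
    (u : List (QueryLetter S)) (wl wr : List (Option Bool)) :
    (readerTM μ step out x₀).Cfg where
  state := q
  input := ⟨il, (u.map some).headD none, (u.map some).tail⟩
  work := fun _ => ⟨wl, wr.headD none, wr.tail⟩
  index := ⟨[], none, []⟩

/-- The rest `u` of the input, when `l` are the pending bits and the rest of the first word is
`v`. -/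
def ScanSpec (x : X) (l v : List Bool) (u : List (QueryLetter S)) : Prop :=
  ∃ (i : List Bool) (a : StdLetter S),
    u = i.map (fun b => some (Sum.inl b)) ++ [none, some (Sum.inr a)] ∧
      l.length + i.length = μ * v.length ∧ out (runBlocks μ step x v (l ++ i)) = a

theorem scanSpec_cons_bit (x : X) (l v : List Bool) (c : Bool) (u : List (QueryLetter S)) :
    ScanSpec μ step out x l v (some (.inl c) :: u) ↔ ScanSpec μ step out x (l ++ [c]) v u := by
  constructor
  · rintro ⟨i, a, hu, hl, ho⟩
    rcases i with _ | ⟨d, i⟩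
    · simp at hu
    · simp only [List.map_cons, List.cons_append, List.cons.injEq, Option.some.injEq,
        Sum.inl.injEq] at hu
      obtain ⟨rfl, rfl⟩ := hu
      refine ⟨i, a, rfl, ?_, by simpa using ho⟩
      rw [← hl]
      simp only [List.length_append, List.length_cons, List.length_nil]
      omega
  · rintro ⟨i, a, rfl, hl, ho⟩
    refine ⟨c :: i, a, rfl, ?_, by simpa using ho⟩
    rw [← hl]
    simp only [List.length_append, List.length_cons, List.length_nil]
    omega

/-- With exactly μ pending bits, the `take μ` and `drop μ` of `runBlocks` split off precisely l. -/
theorem scanSpec_block (x : X) (l v : List Bool) (b : Bool) (u : List (QueryLetter S))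
    (hl : l.length = μ) :
    ScanSpec μ step out x l (b :: v) u ↔
      ScanSpec μ step out (step x b (binaryValue l)) [] v u := by
  have e : ∀ i : List Bool, runBlocks μ step x (b :: v) (l ++ i) =
      runBlocks μ step (step x b (binaryValue l)) v ([] ++ i) := fun i => by
    simp [runBlocks, ← hl]
  unfold ScanSpec
  simp only [e, hl, List.length_cons, List.length_nil, mul_add, mul_one, zero_add]
  simp only [add_comm μ, add_left_inj]

variable [Finite X]

/-- Since there are no query states, every step reduces to evaluating `readerTrans` at the first
remaining letter. -/
theorem readerTM_step (w : List (QueryLetter S)) (q : ReaderState X μ)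
    (il : List (Option (QueryLetter S))) (u : List (QueryLetter S)) (wl wr : List (Option Bool)) :
    (readerTM μ step out x₀).step w (readerCfg μ step out x₀ q il u wl wr) =
      (readerTrans μ step out x₀ q u.head? (wr.headD none)).map fun a =>
        (readerTM μ step out x₀).perform a (readerCfg μ step out x₀ q il u wl wr) := by
  have h : (readerTM μ step out x₀).inputLetter w (readerCfg μ step out x₀ q il u wl wr) =
      u.head? := by
    unfold RandomAccessTM.inputLetter
    exact (if_neg (Set.notMem_empty q)).trans (by cases u <;> rfl)
  unfold RandomAccessTM.step RandomAccessTM.action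
  rw [h]
  rfl


theorem readerCfg_accepting (q : ReaderState X μ) (il : List (Option (QueryLetter S)))
    (u : List (QueryLetter S)) (wl wr : List (Option Bool)) :
    (readerCfg μ step out x₀ q il u wl wr).state ∈ (readerTM μ step out x₀).accepting ↔
      q = .accept :=
  Iff.rfl

theorem decides_atEnd (w : List (QueryLetter S)) (il : List (Option (QueryLetter S)))
    (u : List (QueryLetter S)) (wl wr : List (Option Bool)) :
    (readerTM μ step out x₀).Decides w (readerCfg μ step out x₀ .atEnd il u wl wr) 1 (u = []) := by
  cases u with
  | nil =>
    refine .of_step (c' := readerCfg μ step out x₀ .accept il [] wl (none :: wr.tail))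
      (.of_halt (P := True) 0 ?_ ?_) ?_ le_rfl (by simp)
    · rw [readerTM_step]; rfl
    · simp [readerCfg_accepting]
    · rw [readerTM_step]; rfl
  | cons a u =>
    refine .of_halt _ ?_ ?_
    · rw [readerTM_step]; rfl
    · simp [readerCfg_accepting]

theorem decides_letter (w : List (QueryLetter S)) (x : X) (il : List (Option (QueryLetter S)))
    (u : List (QueryLetter S)) (wl wr : List (Option Bool)) :
    (readerTM μ step out x₀).Decides w (readerCfg μ step out x₀ (.letter x) il u wl wr) 2
      (u = [some (.inr (out x))]) := by
  rcases u with _ | ⟨_ | b | a, u⟩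
  · refine .of_halt _ ?_ ?_
    · rw [readerTM_step]; rfl
    · simp [readerCfg_accepting]
  · refine .of_halt _ ?_ ?_
    · rw [readerTM_step]; rfl
    · simp [readerCfg_accepting]
  · refine .of_halt _ ?_ ?_
    · rw [readerTM_step]; rfl
    · simp [readerCfg_accepting]
  · by_cases h : a = out x
    · refine .of_step (decides_atEnd μ step out x₀ w (some (some (.inr a)) :: il) u wl
        (none :: wr.tail)) ?_ le_rfl (by simp [h])
      rw [readerTM_step]
      simp only [readerTrans, List.head?_cons, if_pos h]
      rfl
    · refine .of_halt _ ?_ ?_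
      · rw [readerTM_step]
        simp only [readerTrans, List.head?_cons, if_neg h]
        rfl
      · simp [readerCfg_accepting, h]

/-- Every step consumes one input letter and keeps fewer than μ bits pending. The final `none` on
the work tape is the blank by which the end of v is recognised. -/
theorem decides_scan (hμ : 0 < μ) (w : List (QueryLetter S)) (x : X)
    (l : {l : List Bool // l.length ≤ μ}) (hl : l.1.length < μ)
    (il : List (Option (QueryLetter S))) (v : List Bool) (u : List (QueryLetter S))
    (wl : List (Option Bool)) :
    (readerTM μ step out x₀).Decides w
      (readerCfg μ step out x₀ (.scan x l) il u wl (v.map some ++ [none])) (u.length + 2)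
      (ScanSpec μ step out x l.1 v u) := by
  induction u generalizing x l il v wl with
  | nil =>
    refine .of_halt _ ?_ ?_
    · rw [readerTM_step]
      rcases v with _ | ⟨b, v⟩ <;> rfl
    · simp [readerCfg_accepting, ScanSpec]
  | cons c u ih =>
    rcases c with _ | c | a
    · rcases v with _ | ⟨b, v⟩
      · by_cases h : l.1 = []
        · refine .of_step (decides_letter μ step out x₀ w x (some none :: il) u wl [none]) ?_
            (m := u.length + 1 + 2) (by omega) ?_
          · rw [readerTM_step]
            simp only [readerTrans, List.head?_cons, List.map_nil, List.nil_append,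
              List.headD_cons, if_pos h]
            rfl
          · constructor
            · rintro rfl
              exact ⟨[], _, rfl, by simp [h], rfl⟩
            · rintro ⟨i, a, hu, hi, ho⟩
              obtain rfl : i = [] := by
                have : l.1.length + i.length = 0 := by simpa using hi
                exact List.eq_nil_of_length_eq_zero (by omega)
              simp only [runBlocks] at ho
              simpa [ho] using hu
        · refine .of_halt _ ?_ ?_
          · rw [readerTM_step]
            simp only [readerTrans, List.head?_cons, List.map_nil, List.nil_append,
              List.headD_cons, if_neg h]
            rfl
          · simp [readerCfg_accepting, ScanSpec, h]
      · refine .of_halt _ ?_ ?_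
        · rw [readerTM_step]; rfl
        · simp only [readerCfg_accepting, reduceCtorEq, false_iff]
          rintro ⟨i, a, hu, hi, -⟩
          rcases i with _ | ⟨d, i⟩
          -- A bit of v is left but i has ended: fewer than μ pending bits cannot fill its block.
          · simp only [List.length_nil, List.length_cons, mul_add] at hi
            omega
          · simp at hu
    · rcases v with _ | ⟨b, v⟩
      · refine .of_halt _ ?_ ?_
        · rw [readerTM_step]; rfl
        · simp only [readerCfg_accepting, reduceCtorEq, false_iff]
          rintro ⟨i, a, hu, hi, -⟩
          rcases i with _ | ⟨d, i⟩
          · simp at hu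
          · simp at hi
      · by_cases h : l.1.length + 1 < μ
        · refine .of_step (ih x ⟨l.1 ++ [c], by simpa using h.le⟩ (by simpa using h)
            (some (some (.inl c)) :: il) (b :: v) wl) ?_ (m := u.length + 1 + 2) (by omega)
            (scanSpec_cons_bit ..).symm
          rw [readerTM_step]
          simp only [readerTrans, List.head?_cons, List.map_cons, List.cons_append,
              List.headD_cons, dif_pos h]
          rfl
        · refine .of_step (ih (step x b (binaryValue (l.1 ++ [c]))) ⟨[], by simp⟩ hμ
            (some (some (.inl c)) :: il) v (some b :: wl)) ?_ (m := u.length + 1 + 2) (by omega) ?_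
          · rw [readerTM_step]
            simp only [readerTrans, List.head?_cons, List.map_cons, List.cons_append,
              List.headD_cons, dif_neg h]
            rfl
          · rw [scanSpec_cons_bit, scanSpec_block]
            simp only [List.length_append, List.length_singleton]
            omega
    · refine .of_halt _ ?_ ?_
      · rw [readerTM_step]
        rcases v with _ | ⟨b, v⟩ <;> rfl
      · simp only [readerCfg_accepting, reduceCtorEq, false_iff]
        rintro ⟨i, a, hu, -⟩
        rcases i with _ | ⟨d, i⟩ <;> simp at hu

/-- The list l is the part of v still to be passed, in reverse, with its first bit under the work
head. For empty l the default `none` is the blank before v, which stops the rewinding. -/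
theorem decides_rewind (hμ : 0 < μ) (w : List (QueryLetter S)) (il : List (Option (QueryLetter S)))
    (l v : List Bool) (u : List (QueryLetter S)) :
    (readerTM μ step out x₀).Decides w
      (readerCfg μ step out x₀ .rewind il u (l.map some).tail
        ((l.map some).headD none :: (v.map some ++ [none]))) (l.length + u.length + 3)
      (ScanSpec μ step out x₀ [] (l.reverse ++ v) u) := by
  induction l generalizing v with
  | nil =>
    refine .of_step (decides_scan μ step out x₀ hμ w x₀ ⟨[], by simp⟩ hμ il v u [none]) ?_
      (by simp only [List.length_nil]; omega) Iff.rfl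
    rw [readerTM_step]
    rfl
  | cons b l ih =>
    refine .of_step (ih (b :: v)) ?_ (by simp only [List.length_cons]; omega) (by simp)
    rw [readerTM_step]
    rfl

/-- Copying a bit costs one step now and one while rewinding, and every letter after the separator
is read at most once, so three steps per letter suffice; the summand `l.length` pays for rewinding
the bits already copied. -/
theorem decides_copy (hμ : 0 < μ) (w : List (QueryLetter S)) (il : List (Option (QueryLetter S)))
    (l : List Bool) (u : List (QueryLetter S)) :
    (readerTM μ step out x₀).Decides w
      (readerCfg μ step out x₀ .copy il u (l.map some) []) (3 * u.length + l.length + 3)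
      (∃ (v : List Bool) (u' : List (QueryLetter S)),
        u = v.map (fun b => some (Sum.inl b)) ++ none :: u' ∧
          ScanSpec μ step out x₀ [] (l.reverse ++ v) u') := by
  induction u generalizing l il with
  | nil =>
    refine .of_halt _ ?_ ?_
    · rw [readerTM_step]; rfl
    · simp [readerCfg_accepting]
  | cons c u ih =>
    rcases c with _ | c | a
    · refine .of_step (decides_rewind μ step out x₀ hμ w (some none :: il) l [] u) ?_
        (by simp only [List.length_cons]; omega) ?_
      · rw [readerTM_step]; rfl
      · constructor
        · exact fun h => ⟨[], u, rfl, h⟩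
        · rintro ⟨v, u', hu, h⟩
          rcases v with _ | ⟨d, v⟩
          · obtain rfl : u = u' := by simpa using hu
            exact h
          · simp at hu
    · refine .of_step (ih (some (some (.inl c)) :: il) (c :: l)) ?_
        (by simp only [List.length_cons]; omega) ?_
      · rw [readerTM_step]; rfl
      · constructor
        · rintro ⟨v, u', rfl, h⟩
          exact ⟨c :: v, u', rfl, by simpa using h⟩
        · rintro ⟨v, u', hu, h⟩
          rcases v with _ | ⟨d, v⟩
          · simp at hu
          · simp only [List.map_cons, List.cons_append, List.cons.injEq, Option.some.injEq,
              Sum.inl.injEq] at hu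
            obtain ⟨rfl, rfl⟩ := hu
            exact ⟨v, u', rfl, by simpa using h⟩
    · refine .of_halt _ ?_ ?_
      · rw [readerTM_step]; rfl
      · simp only [readerCfg_accepting, reduceCtorEq, false_iff]
        rintro ⟨v, u', hu, -⟩
        rcases v with _ | ⟨d, v⟩ <;> simp at hu

/-- If the letters of the words `g d v` with `|v| = d` are computed by a finite automaton that reads
`v` and the position simultaneously, then they can be queried in linear time. -/
theorem dlintime_letterLanguage [Finite S] (hμ : 0 < μ)
    (g : ℕ → List Bool → List (StdLetter S))
    (hg : ∀ v i : List Bool, i.length = μ * v.length →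
      (g v.length v)[binaryValue i]? = some (out (runBlocks μ step x₀ v i))) :
    DLINTIME (letterLanguage μ g) := by
  refine DLINTIME_of_decides (readerTM μ step out x₀) 3 fun w => ?_
  have h := decides_copy μ step out x₀ hμ w [] [] w
  obtain ⟨t, c, ht, hi, hs, ha⟩ := h
  refine ⟨t, c, ht, hi, hs, ha.trans ⟨?_, ?_⟩⟩
  · rintro ⟨v, _, rfl, i, a, rfl, hl, rfl⟩
    refine ⟨v, i, _, by simp [encodeQuery], ?_, hg v i ?_⟩ <;> simpa using hl
  · rintro ⟨v, i, a, rfl, hl, h⟩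
    refine ⟨v, _, by simp [encodeQuery], i, a, rfl, by simpa using hl, ?_⟩
    rw [hg v i hl] at h
    exact Option.some.inj h

end

/-! ### The theorem -/

theorem uniformlySENSFor_of_wreathProduct {S : Type} [Finite S] {G H Y : Type*} [Group G] [Group H]
    [MulAction H Y] [Nontrivial G] (ι : WreathProduct G H Y →* G) (hι : Function.Injective ι)
    (h : H) (y : Y) (hy : h • y ≠ y) (π : FreeGroup S →* G) (hπ : Function.Surjective π) :
    UniformlySENSFor π := by
  let φ : G →* G := ι.comp (SemidirectProduct.inl.comp (coordinateHom G y))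
  -- The word at the root has length 2^0 = 1, so a single letter of nontrivial value is needed.
  obtain ⟨a₀, ha₀⟩ := exists_letterValue_ne_one π hπ
  -- The index `none` stands for the element t and `some b` for the image of the letter b under φ,
  -- so one length serves for all these words.
  obtain ⟨n, hn⟩ := exists_length_forall_wordValue_eq π hπ
    fun a : Option (StdLetter S) => a.elim (ι (SemidirectProduct.inr h)) fun b => φ (letterValue π b)
  -- Positivity of μ is what the scanning phase needs: its empty list of pending bits must be
  -- shorter than a block.
  obtain ⟨μ, hμ, hnμ⟩ : ∃ μ, 0 < μ ∧ n ≤ 2 ^ μ :=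
    ⟨n + 1, n.succ_pos, (Nat.le_succ n).trans Nat.lt_two_pow_self.le⟩
  obtain ⟨σ, hσ⟩ := hn _ hnμ
  let step := blockLetter (fun a => σ (some a)) (σ none)
  let leaf : List Bool → List (StdLetter S) := fun v => (leafWord μ step a₀ v).map Prod.fst
  have hleaf : ∀ v, nestedWordCommutator (v.length - v.length) leaf v = leaf v := fun v => by
    rw [Nat.sub_self]; rfl
  refine ⟨μ, fun d v => nestedWordCommutator (d - v.length) leaf v, ?_, ?_, ?_, ?_⟩
  · rintro _ v rfl
    simp only [hleaf, leaf, List.length_map, length_leafWord]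
  · intro d v hv
    obtain ⟨k, hk⟩ : ∃ k, d - v.length = k + 1 := ⟨d - v.length - 1, by omega⟩
    have hk' : ∀ b : Bool, d - (v ++ [b]).length = k := fun b => by
      simp only [List.length_append, List.length_singleton]
      omega
    simp only [hk, hk', nestedWordCommutator]
  · intro d
    rw [wordValue_nestedWordCommutator]
    refine nestedCommutator_ne_one ι hι y h hy _ ?_ (fun v => ?_) (fun v => ?_) _
    · simpa [leaf, leafWord, wordValue] using ha₀
    · exact wordValue_leafWord_false π _ _ φ (fun a => (hσ (some a)).1) (fun a => (hσ (some a)).2)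
        a₀ v
    · exact (wordValue_leafWord_true π _ _ (hσ none).1 a₀ v).trans (hσ none).2
  · refine dlintime_letterLanguage μ step Prod.fst (a₀, true) hμ _ fun v i hi => ?_
    simp only [hleaf, leaf, List.getElem?_map, getElem?_leafWord μ step a₀ v i hi, Option.map_some]

theorem mainTheorem10 {G H Y : Type*} [Group G] [Group H] [MulAction H Y]
    (hG : Group.FG G)
    (hH : ∃ (h : H) (y : Y), h • y ≠ y)
    (ι : WreathProduct G H Y →* G) (hι : Function.Injective ι) :
    UniformlySENS G := by
  obtain ⟨h, y, hy⟩ := hH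
  -- Since h moves y, it is not the identity, and its image in G is nontrivial.
  have : Nontrivial G := by
    refine ⟨⟨ι (SemidirectProduct.inr h), 1, fun e => hy ?_⟩⟩
    rw [map_eq_one_iff _ hι, map_eq_one_iff _ SemidirectProduct.inr_injective] at e
    rw [e, one_smul]
  exact ⟨hG, fun S _ π hπ => uniformlySENSFor_of_wreathProduct ι hι h y hy π hπ⟩
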